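/- Let $\mathcal{H}=(V,E)$ be a hypergraph: $V$ is a finite non-empty set and $E$ is a finite multiset of non-empty subsets of $V$ (the hyperedges). Let $\mathrm{Bip}\,\mathcal{H}$ be its associated bipartite graph, with color classes $V$ and $E$, in which $v\in V$ is adjacent to $e\in E$ if and only if $v\in e$. For $E'\subseteq E$ let $\mu(E')=|\bigcup E'|-c(E')$, where $c(E')$ is the number of connected components of the subgraph of $\mathrm{Bip}\,\mathcal{H}$ formed by $E'$, all edges incident with $E'$ and their endpoints in $V$ (so $\mu(\emptyset)=0$). Let $$P_{\mathcal{H}}=\Big\{\mathbf a\in\mathbb{Z}^{E} : \sum_{e\in E'}a_e\le\mu(E')\text{ for all }E'\subseteq E,\ \sum_{e\in E}a_e=\mu(E)\Big\}$$ be the hypergraphical polymatroid of $\mathcal{H}$. Fix any linear order on $E$. For $\mathbf a\in P_{\mathcal{H}}$, call $e\in E$ externally active if $\mathbf a+\mathbf e_{e}-\mathbf e_{e'}\notin P_{\mathcal{H}}$ for every $e'<e$ (where $\mathbf e_e$ are the standard basis vectors), and let $\overline{\epsilon}(\mathbf a)$ be the number of $e\in E$ that are not externally active. Let $X_{\mathcal{H}}(y)=\sum_{\mathbf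 a\in P_{\mathcal{H}}}y^{\overline{\epsilon}(\mathbf a)}$ be the exterior polynomial of $\mathcal{H}$. Let $0\le k\le |E|$, and if $k=0$ assume in addition that $\mathrm{Bip}\,\mathcal{H}$ is connected. Then the coefficient of $y^i$ in $X_{\mathcal{H}}$ equals $\binom{|V|+i-2}{i}$ for all $i\le k$ if and only if the graph $\mathrm{Bip}\,\mathcal{H}-E'$ (obtained by deleting the elements of $E'$ and the edges incident with them) is connected for every $E'\subseteq E$ with $|E'|=k$. Here $\binom{m}{0}=1$ for every integer $m$. -/

import Mathlib

/-- The polymatroid `P_f ⊆ ℤ^ι` (the set of integer bases) with rank function `f`: integer vectors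
`a` with `∑_{i ∈ I} a i ≤ f I` for all `I`, with equality for the whole ground set `ι`. -/
def polymatroidBases {ι : Type*} [Fintype ι] (f : Finset ι → ℤ) : Set (ι → ℤ) :=
  {a | (∀ I : Finset ι, ∑ i ∈ I, a i ≤ f I) ∧ ∑ i, a i = f Finset.univ}

theorem polymatroidBases_finite {ι : Type*} [Fintype ι] (f : Finset ι → ℤ) :
    (polymatroidBases f).Finite := by
  classical
  refine (Set.finite_Icc (fun i => f Finset.univ - f (Finset.univ.erase i))
    (fun i => f {i})).subset ?_
  rintro a ⟨h1, h2⟩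
  refine ⟨fun i => ?_, fun i => ?_⟩
  · have h3 := h1 (Finset.univ.erase i)
    have h4 := Finset.sum_erase_add Finset.univ a (Finset.mem_univ i)
    show f Finset.univ - f (Finset.univ.erase i) ≤ a i
    linarith
  · simpa using h1 {i}

/-- The set `Ext_P(a)` of externally active indices of `a` with respect to `P ⊆ ℤ^ι`, for a linearly
ordered ground set `ι`: those `i` such that `a + e_i - e_j ∉ P` for every `j < i`. -/
def externallyActive {ι : Type*} [LinearOrder ι] (P : Set (ι → ℤ)) (a : ι → ℤ) : Set ι :=
  {i | ∀ j : ι, j < i → a + Pi.single i 1 - Pi.single j 1 ∉ P}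

/-- The exterior polynomial `X_P(y) = ∑_{a ∈ P} y ^ (|ι| - |Ext_P(a)|)` of a finite `P ⊆ ℤ^ι`. -/
noncomputable def exteriorPolynomial {ι : Type*} [Fintype ι] [LinearOrder ι]
    (P : Set (ι → ℤ)) (hP : P.Finite) : Polynomial ℕ :=
  ∑ a ∈ hP.toFinset, Polynomial.X ^ (Fintype.card ι - (externallyActive P a).ncard)

/-- A hypergraph with vertex set `V` and a multiset of non-empty hyperedges, given as a family of
non-empty subsets of `V` indexed by `E` (so that hyperedges may be repeated). -/
structure MultiHypergraph (V E : Type*) where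
  edge : E → Set V
  edge_nonempty : ∀ e, (edge e).Nonempty

namespace MultiHypergraph

/-- The associated bipartite graph, with color classes `V` and `E`, in which `v` is adjacent to `e`
if and only if `v ∈ e`. -/
def bip {V E : Type*} (H : MultiHypergraph V E) : SimpleGraph (V ⊕ E) where
  Adj x y := (∃ v e, v ∈ H.edge e ∧ x = Sum.inl v ∧ y = Sum.inr e) ∨
    (∃ v e, v ∈ H.edge e ∧ x = Sum.inr e ∧ y = Sum.inl v)
  symm := ⟨by
    rintro x y (⟨v, e, h, hx, hy⟩ | ⟨v, e, h, hx, hy⟩)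
    · exact Or.inr ⟨v, e, h, hy, hx⟩
    · exact Or.inl ⟨v, e, h, hy, hx⟩⟩
  loopless := ⟨by
    rintro x (⟨v, e, _, hx, hy⟩ | ⟨v, e, _, hx, hy⟩)
    · simp [hx] at hy
    · simp [hx] at hy⟩

/-- The union `⋃ E'` of a set of hyperedges. -/
def edgeUnion {V E : Type*} (H : MultiHypergraph V E) (E' : Finset E) : Set V :=
  ⋃ e ∈ E', H.edge e

/-- The bipartite graph formed by `E'`, all edges of the associated bipartite graph incident with
`E'`, and the endpoints of these edges in `V`. -/
abbrev bipRestrict {V E : Type*} (H : MultiHypergraph V E) (E' : Finset E) :=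
  H.bip.induce (Sum.inl '' H.edgeUnion E' ∪ Sum.inr '' (E' : Set E))

/-- The rank function `μ(E') = |⋃ E'| - c(E')`, where `c(E')` is the number of connected components
of `H.bipRestrict E'` (for finite `V` and `E`). The convention `μ(∅) = 0` is the lemma `rank_empty` below. -/
noncomputable def rank {V E : Type*} (H : MultiHypergraph V E) (E' : Finset E) : ℤ :=
  ((H.edgeUnion E').ncard : ℤ) - (Nat.card (H.bipRestrict E').ConnectedComponent : ℤ)

theorem rank_empty {V E : Type*} (H : MultiHypergraph V E) : H.rank ∅ = 0 := by
  have hempty : IsEmpty (H.bipRestrict ∅).ConnectedComponent := by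
    refine ⟨fun c => ?_⟩
    induction c using SimpleGraph.ConnectedComponent.ind with
    | _ v =>
      obtain ⟨v, hv⟩ := v
      simp [edgeUnion] at hv
  have hcard : Nat.card (H.bipRestrict ∅).ConnectedComponent = 0 := Nat.card_of_isEmpty
  rw [rank, hcard]
  simp [edgeUnion]

/-- The hypergraphical polymatroid `P_H`: the set of hypertrees of `H`. -/
noncomputable def polymatroid {V E : Type*} [Fintype E] (H : MultiHypergraph V E) : Set (E → ℤ) :=
  polymatroidBases H.rank

/-- The exterior polynomial `X_H` of a hypergraph, computed with the given linear order of `E`. -/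
noncomputable def exterior {V E : Type*} [Fintype E] [LinearOrder E] (H : MultiHypergraph V E) :
    Polynomial ℕ :=
  exteriorPolynomial H.polymatroid (polymatroidBases_finite H.rank)

/-- The graph obtained from the associated bipartite graph by deleting the elements of `E'`
(and the edges incident with them); all of `V` is kept. -/
abbrev bipDelete {V E : Type*} (H : MultiHypergraph V E) (E' : Finset E) :=
  H.bip.induce (Sum.inr '' (E' : Set E))ᶜ

end MultiHypergraph

/-! The proof counts lattice points. Write `f` for the rank function, `m = |E|` and `r = f univ`,
and call `b ∈ ℕ^E` "above" if it dominates some base. The vectors above with sum `r + t` split into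
cones, one per base `a`, spanned by the externally active directions of `a` (`card_above_eq_sum`).
Their number is therefore the sum over `j < m` of the coefficient of `y^j` times `(m -
j).multichoose t`. The number of all vectors of that sum has the same kind of expansion, with
coefficients `r.multichoose j` (`Nat.multichoose_add`). Subtracting, the defects `r.multichoose j -
coeff j` are the coordinates of the number of vectors not above (`cardNotAbove_eq_sum`). As
functions of `t`, the terms `(m - j).multichoose t` have strictly decreasing growth in `j`, so the
growth of that number detects the first nonzero defect.

A vector is not above only if its sum over some `S` is less than `f univ - f Sᶜ` (`exists_base_le`).
If deleting any `s` elements preserves the rank, such `S` have more than `s` elements and carry a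
bounded sum, so there are few such vectors and the defects vanish up to `s`. Conversely, if `f Sᶜ <
f univ`, every vector vanishing on `S` fails to be above, and the defect at `|S|` is positive if all
earlier ones vanish.

For hypergraphs, `f` is the codimension of the space of functions on `V` constant on the chosen
hyperedges. This makes it submodular and identifies connectedness with `f = |V| - 1`. If `Bip H` is
disconnected, then `k ≥ 1` and both sides fail, the left one already at the linear coefficient. -/

namespace MultiHypergraph

/-! ### The rank function as a codimension. -/

variable {V E : Type*} (H : MultiHypergraph V E)

/-- The rational functions on the vertices that are constant on every hyperedge in `T`. -/
def edgeConstant (T : Finset E) : Submodule ℚ (V → ℚ) where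
  carrier := {g | ∀ e ∈ T, ∀ u ∈ H.edge e, ∀ v ∈ H.edge e, g u = g v}
  add_mem' ha hb e he u hu v hv := by
    simp only [Pi.add_apply, ha e he u hu v hv, hb e he u hu v hv]
  zero_mem' := by simp
  smul_mem' c g hg e he u hu v hv := by simp only [Pi.smul_apply, hg e he u hu v hv]

theorem mem_edgeConstant {T : Finset E} {g : V → ℚ} :
    g ∈ H.edgeConstant T ↔ ∀ e ∈ T, ∀ u ∈ H.edge e, ∀ v ∈ H.edge e, g u = g v :=
  Iff.rfl

theorem edgeConstant_anti {S T : Finset E} (h : S ⊆ T) :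
    H.edgeConstant T ≤ H.edgeConstant S :=
  fun _ hg e he => hg e (h he)

theorem edgeConstant_union [DecidableEq E] (S T : Finset E) :
    H.edgeConstant (S ∪ T) = H.edgeConstant S ⊓ H.edgeConstant T := by
  ext g
  simp only [Submodule.mem_inf, mem_edgeConstant, Finset.mem_union]
  exact ⟨fun h => ⟨fun e he => h e (.inl he), fun e he => h e (.inr he)⟩,
    fun h e he => he.elim (h.1 e) (h.2 e)⟩

theorem bip_adj_inl_inr {v : V} {e : E} : H.bip.Adj (.inl v) (.inr e) ↔ v ∈ H.edge e := by
  simp [bip]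

/-- Extends a function on the vertices to the hyperedges. -/
noncomputable def extendToEdges (g : V → ℚ) : V ⊕ E → ℚ :=
  Sum.elim g fun e => g (H.edge_nonempty e).some

theorem extendToEdges_eq_of_reachable {T : Finset E} {A : Set (V ⊕ E)}
    (hA : ∀ e, Sum.inr e ∈ A → e ∈ T) {g : V → ℚ} (hg : g ∈ H.edgeConstant T) {x y : A}
    (h : (H.bip.induce A).Reachable x y) :
    H.extendToEdges g x = H.extendToEdges g y := by
  obtain ⟨p⟩ := h
  induction p with
  | nil => rfl
  | @cons x y z hxy _ ih =>
    rw [← ih]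
    obtain ⟨x, hx⟩ := x
    obtain ⟨y, hy⟩ := y
    have hxy' : H.bip.Adj x y := hxy
    rcases hxy' with ⟨v, e, hve, rfl, rfl⟩ | ⟨v, e, hve, rfl, rfl⟩
    · exact hg e (hA e hy) _ hve _ (H.edge_nonempty e).some_mem
    · exact hg e (hA e hx) _ (H.edge_nonempty e).some_mem _ hve

/-- The space is the pullback of all functions along the map `π` that sends a vertex in `A` to its
component and keeps the other vertices apart. Every component contains a vertex because hyperedges
are non-empty, so `π` is surjective and the pullback injective. Leaving `A` general serves both
`bipRestrict` and graphs that keep all of `V`. -/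
theorem finrank_edgeConstant [Fintype V] [Finite E] {T : Finset E} {A : Set (V ⊕ E)}
    (hA : ∀ e, Sum.inr e ∈ A ↔ e ∈ T) (hA' : ∀ e ∈ T, ∀ v ∈ H.edge e, Sum.inl v ∈ A) :
    Module.finrank ℚ (H.edgeConstant T) =
      Nat.card {v : V // Sum.inl v ∉ A} + Nat.card (H.bip.induce A).ConnectedComponent := by
  classical
  have : Fintype (H.bip.induce A).ConnectedComponent := Fintype.ofFinite _
  let π : V → {v : V // Sum.inl v ∉ A} ⊕ (H.bip.induce A).ConnectedComponent := fun v =>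
    if h : Sum.inl v ∈ A then .inr ((H.bip.induce A).connectedComponentMk ⟨.inl v, h⟩)
    else .inl ⟨v, h⟩
  have hadj : ∀ {e v} (he : Sum.inr e ∈ A) (hv : v ∈ H.edge e),
      (H.bip.induce A).Adj ⟨.inl v, hA' e ((hA e).1 he) v hv⟩ ⟨.inr e, he⟩ :=
    fun he hv => H.bip_adj_inl_inr.2 hv
  have hπ : Function.Surjective π := by
    rintro (⟨v, hv⟩ | c)
    · exact ⟨v, by simp [π, hv]⟩
    · induction c using SimpleGraph.ConnectedComponent.ind with
      | _ x =>
      obtain ⟨v | e, hx⟩ := x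
      · exact ⟨v, by simp [π, hx]⟩
      · obtain ⟨v, hv⟩ := H.edge_nonempty e
        refine ⟨v, ?_⟩
        simp only [π, hA' e ((hA e).1 hx) v hv, dite_true]
        exact congrArg _ (SimpleGraph.ConnectedComponent.connectedComponentMk_eq_of_adj (hadj hx hv))
  have hrange : LinearMap.range (LinearMap.funLeft ℚ ℚ π) = H.edgeConstant T := by
    ext g
    constructor
    · rintro ⟨h, rfl⟩ e he u hu v hv
      have huv : π u = π v := by
        simp only [π, hA' e he u hu, hA' e he v hv, dite_true]
        refine congrArg _ (SimpleGraph.ConnectedComponent.sound ?_)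
        have heA := (hA e).2 he
        exact (hadj heA hu).reachable.trans (hadj heA hv).reachable.symm
      simp [LinearMap.funLeft_apply, huv]
    · intro hg
      refine ⟨fun y => g (Function.surjInv hπ y), ?_⟩
      funext v
      have h := Function.surjInv_eq hπ (π v)
      rw [LinearMap.funLeft_apply]
      set u := Function.surjInv hπ (π v)
      by_cases hu : Sum.inl u ∈ A <;> by_cases hv : Sum.inl v ∈ A <;>
        simp only [π, hu, hv, dite_true, dite_false, Sum.inr.injEq, Sum.inl.injEq,
          reduceCtorEq, Subtype.mk.injEq] at h
      · exact H.extendToEdges_eq_of_reachable (fun e => (hA e).1) hg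
          (SimpleGraph.ConnectedComponent.exact h)
      · rw [h]
  rw [← hrange, LinearMap.finrank_range_of_inj
    (LinearMap.funLeft_injective_of_surjective ℚ ℚ π hπ), Module.finrank_fintype_fun_eq_card,
    Fintype.card_sum, Nat.card_eq_fintype_card, Nat.card_eq_fintype_card]

theorem rank_eq_card_sub_finrank [Fintype V] [Finite E] (T : Finset E) :
    H.rank T = Fintype.card V - Module.finrank ℚ (H.edgeConstant T) := by
  rw [H.finrank_edgeConstant (T := T)
    (A := Sum.inl '' H.edgeUnion T ∪ Sum.inr '' (T : Set E)) (by simp)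
    (fun e he v hv => by
      simp only [Set.mem_union, Set.mem_image, Sum.inl.injEq, exists_eq_right]
      exact .inl (Set.mem_biUnion he hv))]
  have h : Nat.card {v : V // Sum.inl v ∉
      (Sum.inl '' H.edgeUnion T ∪ Sum.inr '' (T : Set E) : Set (V ⊕ E))} =
      (H.edgeUnion T)ᶜ.ncard := by
    rw [← Nat.card_coe_set_eq]
    congr!
    simp
  have h2 := Set.ncard_add_ncard_compl (H.edgeUnion T)
  rw [h, rank, ← Nat.card_eq_fintype_card, ← h2]
  push_cast
  ring

theorem rank_mono [Fintype V] [Finite E] {S T : Finset E} (h : S ⊆ T) : H.rank S ≤ H.rank T := by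
  rw [rank_eq_card_sub_finrank, rank_eq_card_sub_finrank]
  have := Submodule.finrank_mono (H.edgeConstant_anti h)
  omega

/-- This is the dimension formula: unions give intersections of subspaces, while the subspace of `S
∩ T` contains, possibly strictly, the sum of the two. -/
theorem rank_union_add_rank_inter_le [Fintype V] [Finite E] [DecidableEq E] (S T : Finset E) :
    H.rank (S ∪ T) + H.rank (S ∩ T) ≤ H.rank S + H.rank T := by
  simp only [rank_eq_card_sub_finrank]
  rw [edgeConstant_union]
  have h1 := Submodule.finrank_sup_add_finrank_inf_eq (H.edgeConstant S) (H.edgeConstant T)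
  have h2 := Submodule.finrank_mono (sup_le (H.edgeConstant_anti Finset.inter_subset_left)
    (H.edgeConstant_anti Finset.inter_subset_right) :
      H.edgeConstant S ⊔ H.edgeConstant T ≤ H.edgeConstant (S ∩ T))
  omega

theorem connected_iff_rank_eq [Fintype V] [Nonempty V] [Finite E] {T : Finset E}
    {A : Set (V ⊕ E)} (hV : ∀ v, Sum.inl v ∈ A) (hA : ∀ e, Sum.inr e ∈ A ↔ e ∈ T) :
    (H.bip.induce A).Connected ↔ H.rank T = Fintype.card V - 1 := by
  rw [rank_eq_card_sub_finrank, H.finrank_edgeConstant hA fun _ _ v _ => hV v]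
  have : IsEmpty {v : V // Sum.inl v ∉ A} := ⟨fun v => v.2 (hV v)⟩
  have : Nonempty A := ⟨⟨_, hV (Classical.arbitrary V)⟩⟩
  rw [Nat.card_of_isEmpty, zero_add]
  constructor
  · intro h
    have := h.preconnected.subsingleton_connectedComponent
    rw [Nat.card_unique]
    simp
  · intro h
    have h1 : Nat.card (H.bip.induce A).ConnectedComponent = 1 := by omega
    have := (Nat.card_eq_one_iff_unique.1 h1).1
    exact ⟨fun x y => SimpleGraph.ConnectedComponent.exact (Subsingleton.elim _ _)⟩

theorem bipDelete_connected_iff [Fintype V] [Nonempty V] [Fintype E] [DecidableEq E]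
    (E' : Finset E) :
    (H.bipDelete E').Connected ↔ H.rank E'ᶜ = Fintype.card V - 1 :=
  H.connected_iff_rank_eq (by simp) (by simp)

/-- The constant functions always survive. -/
theorem rank_le [Fintype V] [Nonempty V] [Finite E] (T : Finset E) :
    H.rank T ≤ Fintype.card V - 1 := by
  have hpos : 0 < Module.finrank ℚ (H.edgeConstant T) := by
    rw [Module.finrank_pos_iff_exists_ne_zero]
    refine ⟨⟨fun _ => 1, fun _ _ _ _ _ _ => rfl⟩, fun h => ?_⟩
    have := congrFun (congrArg Subtype.val h) (Classical.arbitrary V)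
    simp at this
  rw [rank_eq_card_sub_finrank]
  omega

end MultiHypergraph

/-! ### Multiset coefficients and their growth. -/

open Finset Filter Asymptotics

theorem Nat.sum_range_multichoose_left (m n : ℕ) :
    ∑ k ∈ range (n + 1), m.multichoose k = (m + 1).multichoose n := by
  induction n with
  | zero => simp
  | succ n ih => rw [sum_range_succ, ih, Nat.multichoose_succ_succ, add_comm]

/-- Expands a shifted count in the functions `t ↦ (m + 1 - j).multichoose t`, the same ones that
arise from the cones. The proof is a double induction with Pascal's rule. -/
theorem Nat.multichoose_add (m r t : ℕ) :
    (m + 1).multichoose (r + t) =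
      ∑ j ∈ range (m + 1), r.multichoose j * (m + 1 - j).multichoose t := by
  induction t generalizing m with
  | zero =>
    simp only [add_zero, Nat.multichoose_zero_right, mul_one]
    induction m with
    | zero => simp
    | succ m ih =>
      rw [sum_range_succ, ← ih]
      cases r with
      | zero => simp
      | succ r =>
        have h : ∀ a b : ℕ, (a + 1).multichoose b = (b + 1).multichoose a := fun a b => by
          have e1 : a + 1 + b - 1 = a + b := by omega
          have e2 : b + 1 + a - 1 = a + b := by omega
          rw [Nat.multichoose_eq, Nat.multichoose_eq, e1, e2, ← Nat.choose_symm_add]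
        rw [Nat.multichoose_succ_succ, h r, add_comm]
  | succ t ih =>
    induction m with
    | zero => simp
    | succ m ihm =>
      rw [← add_assoc, Nat.multichoose_succ_succ, add_assoc, ihm, ih, sum_range_succ _ (m + 1),
        sum_range_succ _ (m + 1), ← add_assoc, ← sum_add_distrib]
      congr 1
      · refine sum_congr rfl fun j hj => ?_
        have hj' : m + 1 + 1 - j = (m + 1 - j) + 1 := by
          have := mem_range.1 hj; omega
        rw [hj', Nat.multichoose_succ_succ, mul_add]
      · simp

theorem Nat.multichoose_mono_left (t : ℕ) : Monotone fun m : ℕ => m.multichoose t := by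
  refine monotone_nat_of_le_succ fun m => ?_
  cases t with
  | zero => simp
  | succ t => simp [Nat.multichoose_succ_succ]

theorem Nat.multichoose_pos (m t : ℕ) : 0 < (m + 1).multichoose t := by
  have h : Nat.multichoose 1 t ≤ (m + 1).multichoose t :=
    Nat.multichoose_mono_left t (by omega)
  rwa [Nat.multichoose_one] at h

theorem Nat.multichoose_mono_right (m : ℕ) : Monotone fun t : ℕ => (m + 1).multichoose t :=
  monotone_nat_of_le_succ fun t => by simp [Nat.multichoose_succ_succ]

theorem Finset.card_piAntidiag_eq_multichoose {ι : Type*} [DecidableEq ι] (s : Finset ι) (n : ℕ) :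
    (piAntidiag s n).card = s.card.multichoose n := by
  induction s using Finset.cons_induction generalizing n with
  | empty => cases n <;> simp
  | cons i s hi ih =>
    simp only [piAntidiag_cons, card_disjiUnion, card_map, ih, card_cons]
    rw [Finset.Nat.sum_antidiagonal_eq_sum_range_succ_mk, ← Nat.sum_range_multichoose_left,
      ← sum_range_reflect]
    refine sum_congr rfl fun j hj => ?_
    have hj2 : n - (n.succ - 1 - j) = j := by have := mem_range.1 hj; omega
    simp only [hj2]

/-- By the identity `key`, the quotient of the two sides is `q / (t + q)`. -/
theorem Nat.multichoose_succ_isLittleO (q : ℕ) :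
    (fun t : ℕ => (q.multichoose t : ℝ)) =o[atTop] fun t => ((q + 1).multichoose t : ℝ) := by
  have key : ∀ t, (q + 1).multichoose t * q = q.multichoose t * (t + q) := fun t => by
    cases q with
    | zero => cases t <;> simp
    | succ q =>
      rw [Nat.multichoose_eq, Nat.multichoose_eq]
      have h := Nat.choose_mul_succ_eq (q + t) t
      have e1 : q + 1 + 1 + t - 1 = q + t + 1 := by omega
      have e2 : q + 1 + t - 1 = q + t := by omega
      have e3 : q + t + 1 - t = q + 1 := by omega
      rw [e3] at h
      rw [e1, e2, ← h]
      ring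
  rw [isLittleO_iff]
  intro c hc
  filter_upwards [eventually_ge_atTop (⌈q / c⌉₊ + 1)] with t ht
  have ht' : (q : ℝ) / c ≤ t := (Nat.le_ceil _).trans (by exact_mod_cast (by omega))
  have ht0 : (0 : ℝ) < t := by exact_mod_cast (by omega : 0 < t)
  rw [div_le_iff₀ hc] at ht'
  have k : ((q + 1).multichoose t : ℝ) * q = q.multichoose t * (t + q) := by
    exact_mod_cast key t
  rw [Real.norm_natCast, Real.norm_natCast]
  have h1 : (q.multichoose t : ℝ) * t ≤ (c * (q + 1).multichoose t) * t := by
    calc (q.multichoose t : ℝ) * t ≤ q.multichoose t * (t + q) := by gcongr; simp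
      _ = (q + 1).multichoose t * q := k.symm
      _ ≤ (q + 1).multichoose t * (t * c) := by gcongr
      _ = _ := by ring
  exact le_of_mul_le_mul_right h1 ht0

theorem Nat.multichoose_isLittleO {p q : ℕ} (h : p < q) :
    (fun t : ℕ => (p.multichoose t : ℝ)) =o[atTop] fun t => (q.multichoose t : ℝ) := by
  induction q, h using Nat.le_induction with
  | base => exact Nat.multichoose_succ_isLittleO p
  | succ q _ ih => exact ih.trans (Nat.multichoose_succ_isLittleO q)

theorem Nat.multichoose_isBigO {p q : ℕ} (h : p ≤ q) :
    (fun t : ℕ => (p.multichoose t : ℝ)) =O[atTop] fun t => (q.multichoose t : ℝ) :=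
  IsBigO.of_bound 1 <| Eventually.of_forall fun t => by
    simpa using (Nat.multichoose_mono_left t h : p.multichoose t ≤ q.multichoose t)

theorem Nat.multichoose_add_isBigO (q r : ℕ) :
    (fun t : ℕ => ((q + 1).multichoose (r + t) : ℝ)) =O[atTop]
      fun t => ((q + 1).multichoose t : ℝ) := by
  simp only [Nat.multichoose_add, Nat.cast_sum, Nat.cast_mul]
  exact IsBigO.fun_sum fun j _ => (Nat.multichoose_isBigO (Nat.sub_le _ _)).const_mul_left _

/-! ### Reading off the first nonzero coefficient from growth. -/

section LeadingCoefficient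

variable {m s : ℕ} {c : ℕ → ℤ} {D : ℕ → ℤ}

/-- The leading term of an integer combination of the functions `t ↦ (m - j).multichoose t`. -/
theorem sub_leadingTerm_isLittleO
    (hD : ∀ t, D t = ∑ j ∈ range m, c j * ((m - j).multichoose t : ℤ)) (hs : s < m)
    (hc : ∀ j < s, c j = 0) :
    (fun t => (D t : ℝ) - c s * ((m - s).multichoose t : ℝ)) =o[atTop]
      fun t => ((m - s).multichoose t : ℝ) := by
  have h : (fun t => (D t : ℝ) - c s * ((m - s).multichoose t : ℝ)) =
      fun t => ∑ j ∈ (range m).erase s, (c j : ℝ) * ((m - j).multichoose t : ℝ) := by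
    funext t
    rw [hD, ← sum_erase_add _ _ (mem_range.2 hs)]
    push_cast
    ring
  rw [h]
  refine IsLittleO.fun_sum fun j hj => ?_
  obtain ⟨hjs, hj⟩ := mem_erase.1 hj
  rcases lt_or_gt_of_ne hjs with hlt | hgt
  · simp only [hc j hlt, Int.cast_zero, zero_mul]
    exact isLittleO_zero _ _
  · exact (Nat.multichoose_isLittleO (by have := mem_range.1 hj; omega)).const_mul_left _

theorem leadingCoeff_eq_zero
    (hD : ∀ t, D t = ∑ j ∈ range m, c j * ((m - j).multichoose t : ℤ)) (hs : s < m)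
    (hc : ∀ j < s, c j = 0)
    (hO : (fun t => (D t : ℝ)) =o[atTop] fun t => ((m - s).multichoose t : ℝ)) : c s = 0 := by
  have h := hO.sub (sub_leadingTerm_isLittleO hD hs hc)
  simp only [sub_sub_cancel] at h
  by_contra hne
  have hne' : (c s : ℝ) ≠ 0 := by exact_mod_cast hne
  have h2 := (isLittleO_const_mul_left_iff hne').1 h
  obtain ⟨t, ht⟩ := ((isLittleO_iff.1 h2) (show (0 : ℝ) < 1 / 2 by norm_num)).exists
  obtain ⟨q, hq⟩ : ∃ q, m - s = q + 1 := ⟨m - s - 1, by omega⟩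
  have hp : (0 : ℝ) < (m - s).multichoose t := by
    rw [hq]; exact_mod_cast Nat.multichoose_pos q t
  rw [Real.norm_natCast] at ht
  linarith

theorem leadingCoeff_pos
    (hD : ∀ t, D t = ∑ j ∈ range m, c j * ((m - j).multichoose t : ℤ)) (hs : s < m)
    (hc : ∀ j < s, c j = 0) (hle : ∀ t, ((m - s).multichoose t : ℤ) ≤ D t) : 0 < c s := by
  obtain ⟨t, ht⟩ := ((isLittleO_iff.1 (sub_leadingTerm_isLittleO hD hs hc))
    (show (0 : ℝ) < 1 / 2 by norm_num)).exists
  obtain ⟨q, hq⟩ : ∃ q, m - s = q + 1 := ⟨m - s - 1, by omega⟩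
  have hp : (0 : ℝ) < (m - s).multichoose t := by
    rw [hq]; exact_mod_cast Nat.multichoose_pos q t
  have hl : ((m - s).multichoose t : ℝ) ≤ D t := by exact_mod_cast hle t
  rw [Real.norm_natCast, Real.norm_eq_abs] at ht
  have h1 := (abs_le.1 ht).2
  have h2 : (0 : ℝ) < c s := by
    by_contra hcs
    nlinarith
  exact_mod_cast h2

end LeadingCoefficient

/-! ### Bases of integer polymatroids. -/

/-- Integer polymatroid rank functions. -/
structure IsPolymatroidRank {ι : Type*} [DecidableEq ι] (f : Finset ι → ℤ) : Prop where
  map_empty : f ∅ = 0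
  mono : Monotone f
  submodular : ∀ S T, f (S ∪ T) + f (S ∩ T) ≤ f S + f T

namespace IsPolymatroidRank

section Bases

variable {ι : Type*} [DecidableEq ι] {f : Finset ι → ℤ}

theorem nonneg (hf : IsPolymatroidRank f) (S : Finset ι) : 0 ≤ f S :=
  hf.map_empty ▸ hf.mono (empty_subset S)

/-- Uncrossing: by submodularity, the union of two tight sets is tight. -/
theorem sum_biUnion_eq_of_tight (hf : IsPolymatroidRank f) {a : ι → ℤ}
    (ha : ∀ S, ∑ i ∈ S, a i ≤ f S) (s : Finset ι) (g : ι → Finset ι)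
    (hg : ∀ i ∈ s, ∑ j ∈ g i, a j = f (g i)) :
    ∑ j ∈ s.biUnion g, a j = f (s.biUnion g) := by
  induction s using Finset.induction_on with
  | empty => simp [hf.map_empty]
  | insert i s _ ih =>
    rw [biUnion_insert]
    have h1 := ih fun i hi => hg i (mem_insert_of_mem hi)
    have h2 := hg i (mem_insert_self _ _)
    have h3 := hf.submodular (g i) (s.biUnion g)
    have h4 := sum_union_inter (s₁ := g i) (s₂ := s.biUnion g) (f := a)
    have h5 := ha (g i ∪ s.biUnion g)
    have h6 := ha (g i ∩ s.biUnion g)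
    linarith

variable [Fintype ι]

/-- If every exchange were blocked, each `i` with `a i < a' i` would lie in a tight set avoiding
`j`. Their union `T` is tight for `a`, and outside it `a' ≤ a`, strictly at `j`. Equality of total
sums then forces `a'` to exceed `f T` on `T`. -/
theorem exchange (hf : IsPolymatroidRank f) {a a' : ι → ℤ} (ha : a ∈ polymatroidBases f)
    (ha' : a' ∈ polymatroidBases f) {j : ι} (hj : a' j < a j) :
    ∃ i, a i < a' i ∧ a + Pi.single i 1 - Pi.single j 1 ∈ polymatroidBases f := by
  by_contra! h
  have tight : ∀ i ∈ univ.filter fun i => a i < a' i,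
      ∃ S : Finset ι, i ∈ S ∧ j ∉ S ∧ ∑ l ∈ S, a l = f S := by
    intro i hi
    by_contra! hS
    refine h i (mem_filter.1 hi).2 ⟨fun S => ?_, ?_⟩
    · have h1 := ha.1 S
      have h2 := hS S
      simp only [Pi.sub_apply, Pi.add_apply, sum_sub_distrib, sum_add_distrib, sum_pi_single']
      split_ifs with hi' hj'
      · omega
      · have := lt_of_le_of_ne h1 (h2 hi' hj')
        omega
      · omega
      · omega
    · simp [sum_sub_distrib, sum_add_distrib, ha.2]
  choose! g hg1 hg2 hg3 using tight
  set T := (univ.filter fun i => a i < a' i).biUnion g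
  have hT : ∑ l ∈ T, a l = f T := hf.sum_biUnion_eq_of_tight ha.1 _ g hg3
  have h1 := ha'.1 T
  have hjT : j ∈ Tᶜ := by
    simp only [T, mem_compl, mem_biUnion, not_exists, not_and]
    exact hg2
  have h2 : ∑ l ∈ Tᶜ, a' l < ∑ l ∈ Tᶜ, a l := by
    refine sum_lt_sum (fun i hi => ?_) ⟨j, hjT, hj⟩
    by_contra! hlt
    refine mem_compl.1 hi (mem_biUnion.2 ⟨i, ?_, hg1 i ?_⟩) <;> simpa using hlt
  have h3 := sum_add_sum_compl T a
  have h4 := sum_add_sum_compl T a'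
  rw [ha.2] at h3
  rw [ha'.2] at h4
  linarith

theorem sub_compl_le_sum {a : ι → ℤ} (ha : a ∈ polymatroidBases f) (S : Finset ι) :
    f univ - f Sᶜ ≤ ∑ i ∈ S, a i := by
  have h1 := ha.1 Sᶜ
  have h2 := sum_add_sum_compl S a
  rw [ha.2] at h2
  linarith

theorem base_nonneg (hf : IsPolymatroidRank f) {a : ι → ℤ} (ha : a ∈ polymatroidBases f) (i : ι) :
    0 ≤ a i := by
  have h1 := sub_compl_le_sum ha {i}
  have h2 := hf.mono (subset_univ ({i} : Finset ι)ᶜ)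
  rw [sum_singleton] at h1
  linarith

/-- Take `c` of largest sum among the nonnegative vectors below `b` that satisfy the rank
inequalities. Each coordinate with `c i < b i` lies in a tight set. On the union `T` of these `c`
sums to `f T`, and off it `c = b`, so the hypothesis at `Tᶜ` makes the total at least `f univ`. -/
theorem exists_base_le (hf : IsPolymatroidRank f) {b : ι → ℤ} (hb : 0 ≤ b)
    (h : ∀ S, f univ - f Sᶜ ≤ ∑ i ∈ S, b i) : ∃ a ∈ polymatroidBases f, a ≤ b := by
  have hfin : {c : ι → ℤ | c ∈ Set.Icc 0 b ∧ ∀ S, ∑ i ∈ S, c i ≤ f S}.Finite :=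
    (Set.finite_Icc 0 b).subset fun c hc => hc.1
  obtain ⟨c, ⟨⟨hc0, hcb⟩, hcf⟩, hmax⟩ := Set.exists_max_image _ (fun c => ∑ i, c i) hfin
    ⟨0, ⟨le_rfl, hb⟩, fun S => by simpa using hf.nonneg S⟩
  have tight : ∀ i ∈ univ.filter fun i => c i < b i,
      ∃ S : Finset ι, i ∈ S ∧ ∑ l ∈ S, c l = f S := by
    intro i hi
    by_contra! hS
    have hi' := (mem_filter.1 hi).2
    have h1 := hmax (c + Pi.single i 1) ⟨⟨fun l => ?_, fun l => ?_⟩, fun S => ?_⟩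
    · simp only [Pi.add_apply, sum_add_distrib, sum_pi_single', mem_univ, if_true] at h1
      omega
    · have := hc0 l
      by_cases hl : l = i
      · subst hl; simp at this ⊢; omega
      · simpa [hl] using this
    · have := hcb l
      by_cases hl : l = i
      · subst hl; simp; omega
      · simpa [hl] using this
    · simp only [Pi.add_apply, sum_add_distrib, sum_pi_single']
      have h2 := hcf S
      split_ifs with hiS
      · have := lt_of_le_of_ne h2 (hS S hiS)
        omega
      · omega
  choose! g hg1 hg2 using tight
  set T := (univ.filter fun i => c i < b i).biUnion g
  have hT : ∑ l ∈ T, c l = f T := hf.sum_biUnion_eq_of_tight hcf _ g hg2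
  have h2 : ∑ l ∈ Tᶜ, c l = ∑ l ∈ Tᶜ, b l := by
    refine sum_congr rfl fun i hi => le_antisymm (hcb i) ?_
    by_contra! hlt
    refine mem_compl.1 hi (mem_biUnion.2 ⟨i, ?_, hg1 i ?_⟩) <;> simpa using hlt
  have h3 := sum_add_sum_compl T c
  have h4 := h Tᶜ
  rw [compl_compl] at h4
  have h5 := hcf univ
  exact ⟨c, ⟨hcf, by linarith⟩, hcb⟩

end Bases

/-! ### The cone decomposition. -/

section Cones

variable {ι : Type*} [Fintype ι] [LinearOrder ι] {f : Finset ι → ℤ}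

/-- Among the bases below `b`, take one maximizing a linear functional with strictly increasing
weights. If `a i < b i` and `i` were not active, moving a unit from some `j < i` to `i` would stay
below `b` and raise the weight. -/
theorem exists_base_le_active {b a₀ : ι → ℤ} (ha₀ : a₀ ∈ polymatroidBases f) (hb : a₀ ≤ b) :
    ∃ a ∈ polymatroidBases f, a ≤ b ∧
      ∀ i, a i < b i → i ∈ externallyActive (polymatroidBases f) a := by
  have hfin : {a | a ∈ polymatroidBases f ∧ a ≤ b}.Finite :=
    (polymatroidBases_finite f).subset fun a ha => ha.1
  let w : ι → ℤ := fun i => ((univ.filter (· < i)).card : ℤ)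
  have hw : StrictMono w := fun i j hij => by
    refine Nat.cast_lt.2 (card_lt_card ((ssubset_iff_of_subset fun l hl => ?_).2 ⟨i, ?_, ?_⟩))
    · simp only [mem_filter, mem_univ, true_and] at hl ⊢; exact hl.trans hij
    · simpa using hij
    · simp
  obtain ⟨a, ⟨ha, hab⟩, hmax⟩ := Set.exists_max_image _ (fun a => ∑ i, w i * a i) hfin
    ⟨a₀, ha₀, hb⟩
  refine ⟨a, ha, hab, fun i hi j hj hP => ?_⟩
  have h1 := hmax _ ⟨hP, fun l => ?_⟩
  · simp only [Pi.sub_apply, Pi.add_apply, mul_sub, mul_add, sum_sub_distrib, sum_add_distrib,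
      Pi.single_apply, mul_ite, mul_one, mul_zero, sum_ite_eq', mem_univ, if_true] at h1
    have := hw hj
    omega
  · have h2 : a l ≤ b l := hab l
    simp only [Pi.sub_apply, Pi.add_apply, Pi.single_apply]
    have h5 : l = i → a l < b l := by rintro rfl; exact hi
    split_ifs with h3 h4 h4
    · have := h5 h3; omega
    · have := h5 h3; omega
    · omega
    · omega

/-- At the smallest index `j` where the bases differ, exchange lets the one larger at `j` give a
unit to some `i > j` at which it is smaller than the other, hence below `b`. This contradicts the
activity of `i`. -/
theorem eq_of_le_active (hf : IsPolymatroidRank f) {a a' b : ι → ℤ}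
    (ha : a ∈ polymatroidBases f) (ha' : a' ∈ polymatroidBases f) (hab : a ≤ b) (hab' : a' ≤ b)
    (hact : ∀ i, a i < b i → i ∈ externallyActive (polymatroidBases f) a)
    (hact' : ∀ i, a' i < b i → i ∈ externallyActive (polymatroidBases f) a') : a = a' := by
  by_contra hne
  obtain ⟨l, hl⟩ := Function.ne_iff.1 hne
  obtain ⟨j, hj, hmin⟩ := exists_min_image (univ.filter fun i => a i ≠ a' i) id
    ⟨l, by simpa using hl⟩
  have hj' := (mem_filter.1 hj).2
  have hlt : ∀ i, i ≠ j → a i ≠ a' i → j < i := fun i hi h =>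
    lt_of_le_of_ne (hmin i (by simpa using h)) hi.symm
  rcases lt_or_gt_of_ne hj' with h | h
  · obtain ⟨i, hi, hP⟩ := hf.exchange ha' ha h
    exact hact' i (hi.trans_le (hab i)) j
      (hlt i (by rintro rfl; exact lt_asymm h hi) hi.ne') hP
  · obtain ⟨i, hi, hP⟩ := hf.exchange ha ha' h
    exact hact i (hi.trans_le (hab' i)) j (hlt i (by rintro rfl; exact lt_asymm h hi) hi.ne) hP

open Classical in
/-- The vectors above some base split into cones spanned by the active directions. -/
theorem card_above_eq_sum (hf : IsPolymatroidRank f) {r : ℕ} (hr : f univ = r) (t : ℕ) :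
    ((piAntidiag univ (r + t)).filter fun b : ι → ℕ =>
      ∃ a ∈ polymatroidBases f, ∀ i, a i ≤ b i).card =
    ∑ a ∈ (polymatroidBases_finite f).toFinset,
      (externallyActive (polymatroidBases f) a).ncard.multichoose t := by
  let cone : (ι → ℤ) → Finset (ι → ℕ) := fun a =>
    (piAntidiag (externallyActive (polymatroidBases f) a).toFinite.toFinset t).image
      fun d i => (a i).toNat + d i
  have hcone : ∀ a ∈ polymatroidBases f, ∀ b ∈ cone a, (∀ i, a i ≤ b i) ∧
      (∀ i, a i < b i → i ∈ externallyActive (polymatroidBases f) a) ∧ ∑ i, b i = r + t := by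
    intro a ha b hb
    obtain ⟨d, hd, rfl⟩ := mem_image.1 hb
    obtain ⟨hd1, hd2⟩ := mem_piAntidiag.1 hd
    have hnn := hf.base_nonneg ha
    refine ⟨fun i => ?_, fun i hi => ?_, ?_⟩
    · have := hnn i
      push_cast
      omega
    · have := hnn i
      push_cast at hi
      exact (Set.Finite.mem_toFinset _).1 (hd2 i (by omega))
    · have h1 : ((∑ i, (a i).toNat : ℕ) : ℤ) = r := by
        rw [← hr, ← ha.2, Nat.cast_sum]
        exact sum_congr rfl fun i _ => Int.toNat_of_nonneg (hnn i)
      have h2 : ∑ i, d i = t := by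
        rw [← hd1]
        exact (sum_subset (subset_univ _) fun i _ hi => by
          by_contra h; exact hi (hd2 i h)).symm
      rw [sum_add_distrib, h2, Nat.cast_injective h1]
  have hcard : ∀ a, (cone a).card =
      (externallyActive (polymatroidBases f) a).ncard.multichoose t := fun a => by
    rw [card_image_of_injective, card_piAntidiag_eq_multichoose, ← Set.ncard_eq_toFinset_card]
    intro d d' h
    funext i
    simpa using congrFun h i
  simp only [← hcard]
  rw [← card_biUnion]
  · congr 1
    ext b
    simp only [mem_filter, mem_biUnion, Set.Finite.mem_toFinset, mem_piAntidiag, mem_univ,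
      implies_true, and_true]
    constructor
    · rintro ⟨hb, a₀, ha₀, hle⟩
      obtain ⟨a, ha, hab, hact⟩ := exists_base_le_active (b := fun i => (b i : ℤ)) ha₀ hle
      have hnn := hf.base_nonneg ha
      refine ⟨a, ha, mem_image.2 ⟨fun i => b i - (a i).toNat, mem_piAntidiag.2 ⟨?_, ?_⟩, ?_⟩⟩
      · have h1 : ∑ i, (b i - (a i).toNat) = t := by
          have h2 : ∑ i, (b i - (a i).toNat) + ∑ i, (a i).toNat = r + t := by
            rw [← hb, ← sum_add_distrib]
            refine sum_congr rfl fun i _ => ?_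
            have := hnn i
            have := hab i
            simp only at this
            omega
          have h1 : ((∑ i, (a i).toNat : ℕ) : ℤ) = r := by
            rw [← hr, ← ha.2, Nat.cast_sum]
            exact sum_congr rfl fun i _ => Int.toNat_of_nonneg (hnn i)
          omega
        rw [← h1]
        refine sum_subset (subset_univ _) fun i _ hi => ?_
        by_contra h
        have h : b i - (a i).toNat ≠ 0 := h
        exact hi ((Set.Finite.mem_toFinset _).2 (hact i (by have := hnn i; omega)))
      · intro i hi
        have hi : b i - (a i).toNat ≠ 0 := hi
        exact (Set.Finite.mem_toFinset _).2 (hact i (by have := hnn i; omega))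
      · funext i
        have := hnn i
        have := hab i
        simp only at this ⊢
        omega
    · rintro ⟨a, ha, hb⟩
      obtain ⟨h1, -, h3⟩ := hcone a ha b hb
      exact ⟨h3, a, ha, h1⟩
  · intro a ha a' ha' hne
    rw [Function.onFun, disjoint_left]
    intro b hb hb'
    have ha := (Set.Finite.mem_toFinset _).1 ha
    have ha' := (Set.Finite.mem_toFinset _).1 ha'
    obtain ⟨h1, h2, -⟩ := hcone a ha b hb
    obtain ⟨h1', h2', -⟩ := hcone a' ha' b hb'
    exact hne (hf.eq_of_le_active (b := fun i => (b i : ℤ)) ha ha' h1 h1' h2 h2')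

end Cones

end IsPolymatroidRank

/-! ### Coefficients of the exterior polynomial. -/

section ExteriorPolynomial

variable {ι : Type*} [Fintype ι] [LinearOrder ι]

theorem exteriorPolynomial_coeff {P : Set (ι → ℤ)} (hP : P.Finite) (j : ℕ) :
    (exteriorPolynomial P hP).coeff j =
      ∑ a ∈ hP.toFinset, if j = Fintype.card ι - (externallyActive P a).ncard then 1 else 0 := by
  simp [exteriorPolynomial, Polynomial.finsetSum_coeff, Polynomial.coeff_X_pow]

theorem ncard_externallyActive_pos [Nonempty ι] (P : Set (ι → ℤ)) (a : ι → ℤ) :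
    0 < (externallyActive P a).ncard := by
  rw [Set.ncard_pos]
  obtain ⟨i, -, hi⟩ := exists_min_image (univ : Finset ι) id univ_nonempty
  exact ⟨i, fun j hj => absurd hj (hi j (mem_univ j)).not_gt⟩

theorem ncard_externallyActive_le (P : Set (ι → ℤ)) (a : ι → ℤ) :
    (externallyActive P a).ncard ≤ Fintype.card ι := by
  rw [← Nat.card_eq_fintype_card, ← Set.ncard_univ]
  exact Set.ncard_le_ncard (Set.subset_univ _)

/-- The least index is always active, so at most `|ι| - 1` indices are inactive. -/
theorem exteriorPolynomial_coeff_card [Nonempty ι] {P : Set (ι → ℤ)} (hP : P.Finite) :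
    (exteriorPolynomial P hP).coeff (Fintype.card ι) = 0 := by
  rw [exteriorPolynomial_coeff]
  refine sum_eq_zero fun a _ => if_neg ?_
  have := ncard_externallyActive_pos P a
  have := ncard_externallyActive_le P a
  omega

theorem sum_multichoose_ncard_externallyActive [Nonempty ι] {P : Set (ι → ℤ)}
    (hP : P.Finite) (t : ℕ) :
    ∑ a ∈ hP.toFinset, (externallyActive P a).ncard.multichoose t =
      ∑ j ∈ range (Fintype.card ι),
        (exteriorPolynomial P hP).coeff j * (Fintype.card ι - j).multichoose t := by
  simp only [exteriorPolynomial_coeff, sum_mul, ite_mul, one_mul, zero_mul]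
  rw [sum_comm]
  refine sum_congr rfl fun a _ => ?_
  have h1 := ncard_externallyActive_pos P a
  have h2 := ncard_externallyActive_le P a
  rw [sum_ite_eq', if_pos (mem_range.2 (by omega)), Nat.sub_sub_self h2]

end ExteriorPolynomial

/-! ### Counting vectors above no base, and comparing coefficients. -/

namespace IsPolymatroidRank

variable {ι : Type*} [Fintype ι] [LinearOrder ι] {f : Finset ι → ℤ}

open Classical in
/-- The number of vectors with sum `n` that lie above no base. -/
noncomputable def cardNotAbove (f : Finset ι → ℤ) (n : ℕ) : ℕ :=
  ((piAntidiag univ n).filter fun b : ι → ℕ =>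
    ¬ ∃ a ∈ polymatroidBases f, ∀ i, a i ≤ b i).card

theorem cardNotAbove_eq_sum [Nonempty ι] (hf : IsPolymatroidRank f) {r : ℕ} (hr : f univ = r)
    (t : ℕ) :
    (cardNotAbove f (r + t) : ℤ) = ∑ j ∈ range (Fintype.card ι),
      ((r.multichoose j : ℤ) -
        (exteriorPolynomial (polymatroidBases f) (polymatroidBases_finite f)).coeff j) *
          ((Fintype.card ι - j).multichoose t : ℤ) := by
  classical
  have h1 := card_filter_add_card_filter_not (s := piAntidiag univ (r + t))
    fun b : ι → ℕ => ∃ a ∈ polymatroidBases f, ∀ i, a i ≤ b i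
  rw [hf.card_above_eq_sum hr, sum_multichoose_ncard_externallyActive,
    card_piAntidiag_eq_multichoose, card_univ] at h1
  obtain ⟨m, hm⟩ : ∃ m, Fintype.card ι = m + 1 := ⟨_, (Nat.sub_add_cancel Fintype.card_pos).symm⟩
  rw [hm, Nat.multichoose_add, ← hm] at h1
  simp only [sub_mul, sum_sub_distrib]
  unfold cardNotAbove
  have h2 := congrArg (Nat.cast : ℕ → ℤ) h1
  push_cast at h2
  linarith

/-- By `exists_base_le`, such a vector has a sum over some `S` that is below `f univ - f Sᶜ ≤ r`; it
is then counted through its restrictions to `S` and `Sᶜ`. The case `S = univ` cannot occur since the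
total is at least `r`. -/
theorem cardNotAbove_le (hf : IsPolymatroidRank f) {r s : ℕ} (hr : f univ = r)
    (hs : ∀ S : Finset ι, S.card < s → f Sᶜ = f univ) (t : ℕ) :
    cardNotAbove f (r + t) ≤ ∑ S ∈ univ.filter (fun S : Finset ι => s ≤ S.card ∧ S ≠ univ),
      ∑ j ∈ range (r + 1), S.card.multichoose j * Sᶜ.card.multichoose (r + t) := by
  classical
  calc cardNotAbove f (r + t)
      ≤ ((univ.filter fun S : Finset ι => s ≤ S.card ∧ S ≠ univ).biUnion fun S =>
          (range (r + 1)).biUnion fun j =>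
            image₂ (· + ·) (piAntidiag S j) (piAntidiag Sᶜ (r + t - j))).card := by
        refine card_le_card fun b hb => ?_
        obtain ⟨hb, hna⟩ := mem_filter.1 hb
        replace hb : ∑ i, b i = r + t := (mem_piAntidiag.1 hb).1
        obtain ⟨S, hS⟩ : ∃ S, ∑ i ∈ S, (b i : ℤ) < f univ - f Sᶜ := by
          by_contra! h
          obtain ⟨a, ha, hab⟩ := hf.exists_base_le (b := fun i => (b i : ℤ))
            (fun i => by simp) h
          exact hna ⟨a, ha, hab⟩
        have hfS := hf.nonneg Sᶜ
        have hbS : ((∑ i ∈ S, b i : ℕ) : ℤ) = ∑ i ∈ S, (b i : ℤ) := by push_cast; rfl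
        refine mem_biUnion.2 ⟨S, mem_filter.2 ⟨mem_univ _, ?_, ?_⟩, mem_biUnion.2
          ⟨∑ i ∈ S, b i, mem_range.2 (by omega), mem_image₂.2
            ⟨fun i => if i ∈ S then b i else 0, ?_, fun i => if i ∈ S then 0 else b i, ?_, ?_⟩⟩⟩
        · by_contra! h
          rw [hs S h] at hS
          omega
        · rintro rfl
          rw [compl_univ, hf.map_empty] at hS
          omega
        · refine mem_piAntidiag.2 ⟨sum_congr rfl fun i hi => if_pos hi, fun i hi => ?_⟩
          by_contra h
          simp [h] at hi
        · have h1 := sum_add_sum_compl S b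
          refine mem_piAntidiag.2 ⟨?_, fun i hi => ?_⟩
          · refine (sum_congr rfl fun i hi => if_neg (mem_compl.1 hi)).trans ?_
            change ∑ i ∈ Sᶜ, b i = _
            omega
          · by_contra h
            simp [mem_compl.not.1 h |> not_not.1] at hi
        · funext i
          by_cases h : i ∈ S <;> simp [h]
    _ ≤ _ := by
        refine card_biUnion_le.trans (sum_le_sum fun S hS => card_biUnion_le.trans
          (sum_le_sum fun j _ => (card_image₂_le _ _ _).trans ?_))
        rw [card_piAntidiag_eq_multichoose, card_piAntidiag_eq_multichoose]
        have h : 0 < Sᶜ.card := by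
          rw [card_pos, nonempty_iff_ne_empty, Ne, compl_eq_empty_iff]
          exact (mem_filter.1 hS).2.2
        obtain ⟨q, hq⟩ : ∃ q, Sᶜ.card = q + 1 := ⟨_, (Nat.sub_add_cancel h).symm⟩
        rw [hq]
        -- Monotonicity in the sum needs `Sᶜ` non-empty, which is why `S ≠ univ` is recorded.
        exact Nat.mul_le_mul_left _ (Nat.multichoose_mono_right q (Nat.sub_le _ _))

theorem cardNotAbove_isLittleO (hf : IsPolymatroidRank f) {r s : ℕ} (hr : f univ = r)
    (hs : ∀ S : Finset ι, S.card ≤ s → f Sᶜ = f univ) :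
    (fun t => (cardNotAbove f (r + t) : ℝ)) =o[atTop]
      fun t => ((Fintype.card ι - s).multichoose t : ℝ) := by
  have h : (fun t => (cardNotAbove f (r + t) : ℝ)) =O[atTop]
      fun t => ((∑ S ∈ univ.filter (fun S : Finset ι => s + 1 ≤ S.card ∧ S ≠ univ),
        ∑ j ∈ range (r + 1), S.card.multichoose j * Sᶜ.card.multichoose (r + t) : ℕ) : ℝ) :=
    IsBigO.of_bound 1 <| Eventually.of_forall fun t => by
      rw [Real.norm_natCast, Real.norm_natCast, one_mul]
      exact_mod_cast hf.cardNotAbove_le hr (fun S hS => hs S (by omega)) t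
  refine h.trans_isLittleO ?_
  push_cast
  refine IsLittleO.fun_sum fun S hS => IsLittleO.fun_sum fun j _ => IsLittleO.const_mul_left ?_ _
  obtain ⟨h1, h2⟩ := (mem_filter.1 hS).2
  have h3 := card_lt_univ_of_notMem (s := S) (x := (not_forall.1 (mt eq_univ_iff_forall.2 h2)).choose)
    (not_forall.1 (mt eq_univ_iff_forall.2 h2)).choose_spec
  have h4 := card_compl S
  obtain ⟨q, hq⟩ : ∃ q, Sᶜ.card = q + 1 := ⟨Sᶜ.card - 1, by omega⟩
  rw [hq]
  exact (Nat.multichoose_add_isBigO q r).trans_isLittleO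
    (Nat.multichoose_isLittleO (by omega))

/-- Every base has sum at least `f univ - f Sᶜ > 0` over `S`, so no vector supported on `Sᶜ`
dominates one. -/
theorem multichoose_le_cardNotAbove {n : ℕ} {S : Finset ι} (hS : f Sᶜ < f univ) :
    Sᶜ.card.multichoose n ≤ cardNotAbove f n := by
  classical
  rw [← card_piAntidiag_eq_multichoose]
  refine card_le_card fun b hb => mem_filter.2 ?_
  obtain ⟨hb1, hb2⟩ := mem_piAntidiag.1 hb
  have hbS : ∀ i ∈ S, b i = 0 := fun i hi => by
    by_contra h
    exact mem_compl.1 (hb2 i h) hi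
  refine ⟨mem_piAntidiag.2 ⟨?_, fun i _ => mem_univ i⟩, ?_⟩
  · rw [← sum_add_sum_compl S, sum_eq_zero hbS, hb1, zero_add]
  · rintro ⟨a, ha, hab⟩
    have h1 := sub_compl_le_sum ha S
    have h2 : ∑ i ∈ S, a i ≤ 0 := sum_nonpos fun i hi => by
      have := hab i
      rwa [hbS i hi] at this
    linarith

variable [Nonempty ι]

theorem exterior_coeff_eq_of_lt (hf : IsPolymatroidRank f) {r s : ℕ} (hr : f univ = r)
    (hs : s < Fintype.card ι) (h : ∀ S : Finset ι, S.card ≤ s → f Sᶜ = f univ) :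
    (exteriorPolynomial (polymatroidBases f) (polymatroidBases_finite f)).coeff s =
      r.multichoose s := by
  induction s using Nat.strong_induction_on with
  | _ s ih =>
  have h1 := leadingCoeff_eq_zero (hf.cardNotAbove_eq_sum hr) hs
    (fun j hj => by
      rw [ih j hj (hj.trans hs) fun S hS => h S (hS.trans hj.le)]
      simp)
    (by simpa using hf.cardNotAbove_isLittleO hr h)
  omega

theorem exterior_coeff_lt (hf : IsPolymatroidRank f) {r : ℕ} (hr : f univ = r) {S : Finset ι}
    (hS : f Sᶜ < f univ) (hSc : S.card < Fintype.card ι)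
    (h : ∀ j < S.card,
      (exteriorPolynomial (polymatroidBases f) (polymatroidBases_finite f)).coeff j =
        r.multichoose j) :
    (exteriorPolynomial (polymatroidBases f) (polymatroidBases_finite f)).coeff S.card <
      r.multichoose S.card := by
  have h1 := leadingCoeff_pos (hf.cardNotAbove_eq_sum hr) hSc
    (fun j hj => by rw [h j hj]; simp)
    (fun t => by
      have h2 := multichoose_le_cardNotAbove (n := r + t) hS
      rw [card_compl] at h2
      obtain ⟨q, hq⟩ : ∃ q, Fintype.card ι - S.card = q + 1 :=
        ⟨Fintype.card ι - S.card - 1, by omega⟩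
      rw [hq] at h2 ⊢
      exact_mod_cast (Nat.multichoose_mono_right q (Nat.le_add_left t r)).trans h2)
  omega

/-- Needed for disconnected `Bip H`, where it keeps the linear coefficient below `|V| - 1`. Either
single deletions preserve the rank and equality holds, or some singleton lowers it and the
inequality is strict. -/
theorem exterior_coeff_one_le (hf : IsPolymatroidRank f) {r : ℕ} (hr : f univ = r) :
    (exteriorPolynomial (polymatroidBases f) (polymatroidBases_finite f)).coeff 1 ≤ r := by
  rcases (Nat.succ_le_of_lt (Fintype.card_pos (α := ι))).eq_or_lt with h1 | h1
  · have h1 : Fintype.card ι = 1 := h1.symm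
    rw [← h1, exteriorPolynomial_coeff_card]
    exact Nat.zero_le _
  · by_cases h : ∀ S : Finset ι, S.card ≤ 1 → f Sᶜ = f univ
    · rw [hf.exterior_coeff_eq_of_lt hr h1 h, Nat.multichoose_one_right]
    · push Not at h
      obtain ⟨S, hS1, hS⟩ := h
      have hS2 : S.card = 1 := by
        refine le_antisymm hS1 (Nat.one_le_iff_ne_zero.2 fun h => hS ?_)
        rw [card_eq_zero.1 h, compl_empty]
      have h2 := hf.exterior_coeff_lt hr (lt_of_le_of_ne (hf.mono (subset_univ _)) hS)
        (hS2 ▸ h1) fun j hj => by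
          obtain rfl : j = 0 := by omega
          refine hf.exterior_coeff_eq_of_lt hr Fintype.card_pos fun S hS => ?_
          rw [card_eq_zero.1 (Nat.le_zero.1 hS), compl_empty]
      rw [hS2, Nat.multichoose_one_right] at h2
      exact h2.le

theorem exterior_coeff_iff (hf : IsPolymatroidRank f) {r k : ℕ} (hr : f univ = r)
    (hk : k ≤ Fintype.card ι) :
    (∀ i ≤ k, (exteriorPolynomial (polymatroidBases f) (polymatroidBases_finite f)).coeff i =
      r.multichoose i) ↔ ∀ S : Finset ι, S.card = k → f Sᶜ = f univ := by
  constructor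
  · intro h S hS
    by_contra hne
    have hlt : f Sᶜ < f univ := lt_of_le_of_ne (hf.mono (subset_univ _)) hne
    rcases hk.lt_or_eq with hk | hk
    · have := hf.exterior_coeff_lt hr hlt (hS ▸ hk) fun j hj => h j (by omega)
      rw [hS, h k le_rfl] at this
      exact lt_irrefl _ this
    -- For `k = |ι|` the coefficient is zero, whereas `r > 0` would make `r.multichoose k` positive.
    · have h1 := h k le_rfl
      rw [hk, exteriorPolynomial_coeff_card, ← hk] at h1
      have h2 := hf.nonneg Sᶜ
      obtain ⟨q, rfl⟩ : ∃ q, r = q + 1 := ⟨r - 1, by omega⟩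
      have := Nat.multichoose_pos q k
      omega
  · intro h i hi
    have h' : ∀ S : Finset ι, S.card ≤ k → f Sᶜ = f univ := fun S hS => by
      obtain ⟨T, hST, -, hT⟩ := exists_subsuperset_card_eq (subset_univ S) hS (by simpa using hk)
      refine le_antisymm (hf.mono (subset_univ _)) ?_
      rw [← h T hT]
      exact hf.mono (compl_subset_compl.2 hST)
    rcases (hi.trans hk).lt_or_eq with hlt | heq
    · exact hf.exterior_coeff_eq_of_lt hr hlt fun S hS => h' S (hS.trans hi)
    -- Here `i = k = |ι|`, so deleting everything preserves the rank and `r = 0`.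
    · have h1 := h' univ (by rw [card_univ]; omega)
      rw [compl_univ, hf.map_empty, hr] at h1
      obtain rfl : r = 0 := by exact_mod_cast h1.symm
      rw [heq, exteriorPolynomial_coeff_card]
      obtain ⟨q, hq⟩ : ∃ q, Fintype.card ι = q + 1 :=
        ⟨_, (Nat.sub_add_cancel Fintype.card_pos).symm⟩
      rw [hq, Nat.multichoose_zero_succ]

end IsPolymatroidRank

/-! ### Application to hypergraphs. -/

namespace MultiHypergraph

variable {V E : Type*} (H : MultiHypergraph V E)

theorem isPolymatroidRank_rank [Fintype V] [Finite E] [DecidableEq E] :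
    IsPolymatroidRank H.rank :=
  ⟨H.rank_empty, fun _ _ h => H.rank_mono h, H.rank_union_add_rank_inter_le⟩

theorem exterior_of_isEmpty [Fintype E] [LinearOrder E] [IsEmpty E] : H.exterior = 1 := by
  have h : H.polymatroid = {0} := by
    ext a
    simp only [polymatroid, polymatroidBases, Set.mem_ofPred_eq, Set.mem_singleton_iff,
      Subsingleton.elim a 0, iff_true]
    refine ⟨fun I => ?_, by simp [H.rank_empty]⟩
    rw [Finset.eq_empty_of_isEmpty I, H.rank_empty]
    simp
  have h2 : (polymatroidBases_finite H.rank).toFinset = {0} := by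
    rw [← Finset.coe_inj, Set.Finite.coe_toFinset, Finset.coe_singleton]
    exact h
  change ∑ a ∈ (polymatroidBases_finite H.rank).toFinset, Polynomial.X ^ _ = 1
  rw [h2]
  simp

end MultiHypergraph

theorem theorem5p8 {V E : Type*} [Fintype V] [Nonempty V] [Fintype E] [LinearOrder E]
    (H : MultiHypergraph V E) (k : ℕ) (hk : k ≤ Fintype.card E)
    (hconn : k = 0 → H.bip.Connected) :
    (∀ i ≤ k, H.exterior.coeff i = (Fintype.card V + i - 2).choose i) ↔
      ∀ E' : Finset E, E'.card = k → (H.bipDelete E').Connected := by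
  have hf : IsPolymatroidRank H.rank := H.isPolymatroidRank_rank
  -- Truncated subtraction matters only for `|V| = 1`, `i = 0`, where both sides are `1`.
  have hchoose : ∀ i, (Fintype.card V + i - 2).choose i = (Fintype.card V - 1).multichoose i := by
    intro i
    obtain ⟨n, hn⟩ : ∃ n, Fintype.card V = n + 1 :=
      ⟨_, (Nat.sub_add_cancel Fintype.card_pos).symm⟩
    rw [Nat.multichoose_eq, hn]
    congr 1
    omega
  simp only [hchoose, H.bipDelete_connected_iff]
  obtain ⟨r, hr⟩ := Int.eq_ofNat_of_zero_le (hf.nonneg Finset.univ)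
  have hrV := H.rank_le Finset.univ
  have hV : 0 < Fintype.card V := Fintype.card_pos
  by_cases hc : H.rank Finset.univ = Fintype.card V - 1
  · have hr' : Fintype.card V - 1 = r := by omega
    rw [hr', ← hc]
    rcases isEmpty_or_nonempty E with hE | hE
    · have hk0 : k = 0 := by simpa using hk
      subst hk0
      refine iff_of_true (fun i hi => ?_) fun S hS => ?_
      · rw [H.exterior_of_isEmpty, Nat.le_zero.1 hi]
        simp
      · rw [Subsingleton.elim Sᶜ Finset.univ]
    · exact hf.exterior_coeff_iff hr hk
  -- The rank is less than `|V| - 1`. The linear coefficient, required because `k ≥ 1`, is then too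
  -- small, and deleting hyperedges cannot restore connectedness.
  · have hk0 : k ≠ 0 := by
      intro h
      refine hc ((H.connected_iff_rank_eq (A := Set.univ) (by simp) (by simp)).1 ?_)
      exact (SimpleGraph.induceUnivIso H.bip).connected_iff.2 (hconn h)
    have : Nonempty E := Fintype.card_pos_iff.1 (by omega)
    refine iff_of_false (fun h => ?_) fun h => ?_
    · have h1 := h 1 (by omega)
      have h2 : H.exterior.coeff 1 ≤ r := hf.exterior_coeff_one_le hr
      rw [Nat.multichoose_one_right] at h1
      omega
    · obtain ⟨S, -, hS⟩ := Finset.exists_subset_card_eq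
        (show k ≤ (Finset.univ : Finset E).card by simpa using hk)
      have h1 := h S hS
      have h2 := hf.mono (Finset.subset_univ Sᶜ)
      omega
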